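/- Let $d\ge 0$, let $h:\mathbb{R}^d\to\{\text{subsets of }\mathbb{R}^d\}$, and let $x_n$, $y_n$ $(n\ge 0)$ and $M_n$ $(n\ge 1)$ be $\mathbb{R}^d$-valued random variables on a probability space such that almost surely, for all $n\ge 0$, $$x_{n+1}=x_n+a(n)\,[\,y_n+M_{n+1}\,],\qquad y_n\in h(x_n).$$ For $c\ge 1$ and $x\in\mathbb{R}^d$ put $h_c(x)=\{y : cy\in h(cx)\}$, and let $h_\infty(x)$ be the closure of the lower limit $\{y : \lim_{c\to\infty} d(y,h_c(x))=0\}$, where $c\to\infty$ through the reals, $d(y,S)=\inf_{z\in S}\|y-z\|$ and $d(y,\emptyset)=\infty$. Assume: * **(A1)** $h$ is a Marchaud map: each $h(x)$ is convex and compact; there is $K>0$ with $\|w\|<K(1+\|x\|)$ for all $x$ and all $w\in h(x)$; and the graph $\{(x,y): y\in h(x)\}$ is closed. * **(A2)** $a(n)>0$ for all $n\ge0$, $\sum_n a(n)=\infty$ and $\sum_n a(n)^2<\infty$. * **(A3)** $(M_n)_{n\ge1}$ is a square integrable martingale difference sequence with respect to $\mathcal F_n=\sigma(x_0,M_1,\dots,M_n)$,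 that is, $E[M_{n+1}\mid\mathcal F_n]=0$ a.s. for $n\ge 0$, and there is $K>0$ with $E[\|M_{n+1}\|^2\mid\mathcal F_n]\le K(1+\|x_n\|^2)$ a.s. for all $n\ge0$. * **(A4)** $h_\infty(x)\ne\emptyset$ for all $x$, and the differential inclusion $\dot x(t)\in h_\infty(x(t))$ has an attracting set $\mathcal A\subseteq\{\|x\|<1\}$ with a fundamental neighborhood containing $\{\|x\|\le 1\}$. That is, $\mathcal A$ is compact and has a neighborhood $U\supseteq\{\|x\|\le1\}$ such that for every $\varepsilon>0$ there is $T\ge0$ for which every solution $\mathbf x$ with $\mathbf x(0)\in U$ satisfies $d(\mathbf x(t),\mathcal A)<\varepsilon$ for all $t\ge T$. A solution is a map $\mathbf x:[0,\infty)\to\mathbb{R}^d$, absolutely continuous on compact intervals, with $\dot{\mathbf x}(t)\in h_\infty(\mathbf x(t))$ for almost every $t\ge 0$. * **(A5)** If $1\le c_1<c_2<\cdots$ are integers, $u_n\to u$ and $v_n\to v$ in $\mathbb{R}^d$, and $v_n\in h_{c_n}(u_n)$ for all $n$, then $v\in h_\infty(u)$. Then $\sup_n\|x_n\|<\infty$ almost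 surely. -/

import Mathlib

open Filter MeasureTheory
open scoped Topology

/-- Marchaud map: convex compact values, linear growth with one constant, closed graph. -/
structure IsMarchaud {d : ℕ}
    (h : EuclideanSpace ℝ (Fin d) → Set (EuclideanSpace ℝ (Fin d))) : Prop where
  convex : ∀ x, Convex ℝ (h x)
  isCompact : ∀ x, IsCompact (h x)
  bounded : ∃ K : ℝ, 0 < K ∧ ∀ x, ∀ w ∈ h x, ‖w‖ < K * (1 + ‖x‖)
  isClosed_graph :
    IsClosed {p : EuclideanSpace ℝ (Fin d) × EuclideanSpace ℝ (Fin d) | p.2 ∈ h p.1}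

/-- `h_c(x) = {y | c y ∈ h(c x)}`. -/
def scaledMap {d : ℕ} (h : EuclideanSpace ℝ (Fin d) → Set (EuclideanSpace ℝ (Fin d)))
    (c : ℝ) (x : EuclideanSpace ℝ (Fin d)) : Set (EuclideanSpace ℝ (Fin d)) :=
  {y | c • y ∈ h (c • x)}

/-- Lower limit of the sets `S c` as the real number `c` tends to infinity: the points `y` with
`d(y, S c) → 0`. The distance to the empty set is `∞`. -/
def lowerLimit {d : ℕ} (S : ℝ → Set (EuclideanSpace ℝ (Fin d))) :
    Set (EuclideanSpace ℝ (Fin d)) :=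
  {y | Tendsto (fun c : ℝ => Metric.infEDist y (S c)) atTop (𝓝 0)}

/-- `h_∞(x)`: the closure of the lower limit of `h_c(x)` as `c → ∞`. -/
def limitMap {d : ℕ} (h : EuclideanSpace ℝ (Fin d) → Set (EuclideanSpace ℝ (Fin d)))
    (x : EuclideanSpace ℝ (Fin d)) : Set (EuclideanSpace ℝ (Fin d)) :=
  closure (lowerLimit fun c => scaledMap h c x)

/-- `φ` is a solution on `[0, ∞)` of `φ' ∈ H(φ)`: absolutely continuous on compact intervals, with
the inclusion at almost every time. Values of `φ` at negative times are irrelevant. -/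
structure IsDISolution {d : ℕ}
    (H : EuclideanSpace ℝ (Fin d) → Set (EuclideanSpace ℝ (Fin d)))
    (φ : ℝ → EuclideanSpace ℝ (Fin d)) : Prop where
  absolutelyContinuous : ∀ b : ℝ, 0 ≤ b → AbsolutelyContinuousOnInterval φ 0 b
  deriv_mem : ∀ᵐ t ∂(volume.restrict (Set.Ioi (0 : ℝ))),
    DifferentiableAt ℝ φ t ∧ deriv φ t ∈ H (φ t)

/-- The set-valued semiflow `Φ_t(x)` of `φ' ∈ H(φ)`. -/
def semiflow {d : ℕ} (H : EuclideanSpace ℝ (Fin d) → Set (EuclideanSpace ℝ (Fin d)))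
    (t : ℝ) (x : EuclideanSpace ℝ (Fin d)) : Set (EuclideanSpace ℝ (Fin d)) :=
  {z | ∃ φ : ℝ → EuclideanSpace ℝ (Fin d), IsDISolution H φ ∧ φ 0 = x ∧ φ t = z}

/-- `A` is an attracting set of `φ' ∈ H(φ)` with fundamental neighborhood `U`. -/
structure IsAttractingSet {d : ℕ}
    (H : EuclideanSpace ℝ (Fin d) → Set (EuclideanSpace ℝ (Fin d)))
    (A U : Set (EuclideanSpace ℝ (Fin d))) : Prop where
  isCompact : IsCompact A
  nhds : U ∈ 𝓝ˢ A
  attracts : ∀ ε : ℝ, 0 < ε → ∃ T : ℝ, 0 ≤ T ∧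
    (⋃ t ∈ Set.Ici T, ⋃ x ∈ U, semiflow H t x) ⊆ Metric.thickening ε A

/-- The σ-algebra generated by `x₀, M₁, …, Mₙ`. -/
@[reducible] def noiseSigma {d : ℕ} {Ω : Type*} (x₀ : Ω → EuclideanSpace ℝ (Fin d))
    (M : ℕ → Ω → EuclideanSpace ℝ (Fin d)) (n : ℕ) : MeasurableSpace Ω :=
  MeasurableSpace.comap x₀ inferInstance ⊔
    ⨆ i ∈ Set.Icc 1 n, MeasurableSpace.comap (M i) inferInstance

/-- `M₁, M₂, …` is a square integrable martingale difference sequence with respect to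
`σ(x₀, M₁, …, Mₙ)`, `n ≥ 0`. The entry `M 0` plays no role. -/
structure IsMartingaleDifference {d : ℕ} {Ω : Type*} [MeasurableSpace Ω] (μ : Measure Ω)
    (x₀ : Ω → EuclideanSpace ℝ (Fin d)) (M : ℕ → Ω → EuclideanSpace ℝ (Fin d)) : Prop where
  measurable_init : Measurable x₀
  measurable : ∀ n, Measurable (M (n + 1))
  memLp : ∀ n, MemLp (M (n + 1)) 2 μ
  condExp_eq_zero : ∀ n, μ[M (n + 1) | noiseSigma x₀ M n] =ᵐ[μ] 0

/-! ### The limiting map -/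

/-! The argument is pathwise: on an almost sure event, an unbounded path contradicts the attractor.
Choose record indices `n k`, where `‖x (n k)‖` exceeds `k` and all earlier norms, start a time `T`
before the record, and divide by the integer `c k = ⌈‖x (n k)‖⌉₊`. Before the record the rescaled
path has norm at most 1; afterwards a discrete Grönwall estimate (`eventually_runningNorm_le`)
bounds it on bounded time spans. Its limit `X` along an ultrafilter is therefore Lipschitz on left
half-lines. By `deriv_limit_mem` it solves the limiting inclusion: its slopes are limits of averages
of rescaled drifts, and these lie near the convex set `limitMap h (X s)`. Now `‖X 0‖ ≤ 1` puts the
start in the fundamental neighborhood, and `T` is chosen so that attraction forces `‖X T‖ < 1`. But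
time `T` is the record, so `‖X T‖ ≥ 1`.

The noise must be negligible relative to the running maximum of the path. Normalizing by that
maximum is not available, since `x n` need not be measurable for the noise σ-algebra.
`ae_exists_tendsto_normalized_noise` divides instead by the running maximum of the conditional
deviations, which is adapted, so square integrable martingale convergence applies. Abel summation
(`norm_sum_smul_sub_le`) removes the normalization, and the conditional variance bound returns to
the path (`ae_noise_le`). -/

theorem mem_lowerLimit_iff {d : ℕ} {S : ℝ → Set (EuclideanSpace ℝ (Fin d))}
    {y : EuclideanSpace ℝ (Fin d)} :
    y ∈ lowerLimit S ↔ ∀ ε : ℝ, 0 < ε → ∀ᶠ c in atTop, ∃ z ∈ S c, dist y z < ε := by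
  constructor
  · intro hy ε hε
    have := (hy : Tendsto _ _ _).eventually (gt_mem_nhds (ENNReal.ofReal_pos.2 hε))
    filter_upwards [this] with c hc
    obtain ⟨z, hz, hlt⟩ := Metric.infEDist_lt_iff.1 hc
    exact ⟨z, hz, by rwa [edist_dist, ENNReal.ofReal_lt_ofReal_iff hε] at hlt⟩
  · intro hy
    refine ENNReal.tendsto_nhds_zero.2 fun ε hε => ?_
    obtain ⟨δ, hδ, hδε⟩ := ENNReal.lt_iff_exists_nnreal_btwn.1 hε
    filter_upwards [hy δ (by exact_mod_cast hδ)] with c ⟨z, hz, hlt⟩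
    refine (Metric.infEDist_le_edist_of_mem hz).trans (le_trans ?_ hδε.le)
    rw [edist_dist, ← ENNReal.ofReal_coe_nnreal]
    exact ENNReal.ofReal_le_ofReal hlt.le

theorem convex_scaledMap {d : ℕ} {h : EuclideanSpace ℝ (Fin d) → Set (EuclideanSpace ℝ (Fin d))}
    (hh : ∀ x, Convex ℝ (h x)) (c : ℝ) (x : EuclideanSpace ℝ (Fin d)) :
    Convex ℝ (scaledMap h c x) := by
  intro y hy z hz p q hp hq hpq
  have := hh _ hy hz hp hq hpq
  simp only [scaledMap, Set.mem_ofPred_eq] at *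
  rwa [smul_add, smul_comm c p, smul_comm c q]

theorem convex_lowerLimit {d : ℕ} {S : ℝ → Set (EuclideanSpace ℝ (Fin d))}
    (hS : ∀ c, Convex ℝ (S c)) : Convex ℝ (lowerLimit S) := by
  intro y hy z hz p q hp hq hpq
  rw [mem_lowerLimit_iff] at *
  intro ε hε
  filter_upwards [hy ε hε, hz ε hε] with c ⟨y', hy', hyd⟩ ⟨z', hz', hzd⟩
  refine ⟨p • y' + q • z', hS c hy' hz' hp hq hpq, ?_⟩
  rw [dist_eq_norm] at *
  have h1 : p • y + q • z - (p • y' + q • z') = p • (y - y') + q • (z - z') := by module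
  rw [h1]
  have h2 := convex_ball (0 : EuclideanSpace ℝ (Fin d)) ε (mem_ball_zero_iff.2 hyd)
    (mem_ball_zero_iff.2 hzd) hp hq hpq
  exact mem_ball_zero_iff.1 h2

theorem convex_limitMap {d : ℕ} {h : EuclideanSpace ℝ (Fin d) → Set (EuclideanSpace ℝ (Fin d))}
    (hh : ∀ x, Convex ℝ (h x)) (x : EuclideanSpace ℝ (Fin d)) : Convex ℝ (limitMap h x) :=
  (convex_lowerLimit fun c => convex_scaledMap hh c x).closure

/-- Linear growth survives scaling with the same constant, uniformly in `c ≥ 1`, because `1 ≤ c`.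
This supplies the compactness for blow-up limits. -/
theorem norm_le_of_mem_scaledMap {d : ℕ}
    {h : EuclideanSpace ℝ (Fin d) → Set (EuclideanSpace ℝ (Fin d))} {K : ℝ} (hK : 0 < K)
    (hb : ∀ x, ∀ w ∈ h x, ‖w‖ < K * (1 + ‖x‖)) {c : ℝ} (hc : 1 ≤ c)
    {u v : EuclideanSpace ℝ (Fin d)} (hv : v ∈ scaledMap h c u) : ‖v‖ ≤ K * (1 + ‖u‖) := by
  have hc0 : 0 < c := by linarith
  have h1 := hb _ _ hv
  rw [norm_smul, norm_smul, Real.norm_of_nonneg hc0.le] at h1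
  have h2 : c * ‖v‖ ≤ c * (K * (1 + ‖u‖)) := by nlinarith
  exact le_of_mul_le_mul_left h2 hc0

/-- Rescaled values near `z` are uniformly close to the limiting values at `z`. -/
theorem exists_scaledMap_subset_cthickening {d : ℕ}
    {h : EuclideanSpace ℝ (Fin d) → Set (EuclideanSpace ℝ (Fin d))} {K : ℝ} (hK : 0 < K)
    (hb : ∀ x, ∀ w ∈ h x, ‖w‖ < K * (1 + ‖x‖))
    (h_lim : ∀ (c : ℕ → ℕ) (u v : ℕ → EuclideanSpace ℝ (Fin d)) (p q : EuclideanSpace ℝ (Fin d)),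
      (∀ n, 1 ≤ c n) → StrictMono c → Tendsto c atTop atTop →
      Tendsto u atTop (𝓝 p) → Tendsto v atTop (𝓝 q) →
      (∀ n, v n ∈ scaledMap h (c n : ℝ) (u n)) → q ∈ limitMap h p)
    (z : EuclideanSpace ℝ (Fin d)) {η : ℝ} (hη : 0 < η) :
    ∃ ε : ℝ, 0 < ε ∧ ∃ N : ℕ, ∀ c : ℕ, N ≤ c → ∀ u, dist u z < ε →
      scaledMap h c u ⊆ Metric.cthickening η (limitMap h z) := by
  by_contra! hcon
  have hpos : ∀ n : ℕ, (0 : ℝ) < 1 / ((n : ℝ) + 1) := fun n => Nat.one_div_pos_of_nat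
  -- The threshold `n + 1` rather than `n` makes every scale at least 1.
  choose c hc u hu hsub using fun n : ℕ => hcon (1 / ((n : ℝ) + 1)) (hpos n) (n + 1)
  choose v hv hvη using fun n => Set.not_subset.1 (hsub n)
  have hc1 : ∀ n, 1 ≤ c n := fun n => (Nat.le_add_left 1 n).trans (hc n)
  have hctop : Tendsto c atTop atTop :=
    tendsto_atTop_mono (fun n => (Nat.le_succ n).trans (hc n)) tendsto_id
  have hulim : Tendsto u atTop (𝓝 z) := by
    rw [tendsto_iff_dist_tendsto_zero]
    exact squeeze_zero (fun _ => dist_nonneg) (fun n => (hu n).le)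
      tendsto_one_div_add_atTop_nhds_zero_nat
  -- `h_lim` requires strictly increasing scales, hence a first extraction before the one by
  -- compactness.
  obtain ⟨φ, hφ, hcφ⟩ := strictMono_subseq_of_tendsto_atTop hctop
  have hvb : ∀ n, v (φ n) ∈ Metric.closedBall (0 : EuclideanSpace ℝ (Fin d))
      (K * (1 + (‖z‖ + 1))) := by
    intro n
    rw [mem_closedBall_zero_iff]
    refine (norm_le_of_mem_scaledMap hK hb (by exact_mod_cast hc1 _) (hv (φ n))).trans ?_
    have h1 : dist (u (φ n)) z < 1 := (hu _).trans_le (by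
      rw [div_le_one (by positivity)]; linarith [(Nat.cast_nonneg (φ n) : (0:ℝ) ≤ _)])
    have h2 : ‖u (φ n)‖ ≤ ‖z‖ + 1 := by
      rw [dist_eq_norm] at h1
      linarith [norm_le_norm_add_norm_sub z (u (φ n)), norm_sub_rev z (u (φ n))]
    gcongr
  obtain ⟨q, -, ψ, hψ, hq⟩ := tendsto_subseq_of_bounded Metric.isBounded_closedBall hvb
  have hmono : StrictMono fun n => φ (ψ n) := hφ.comp hψ
  have hqmem : q ∈ limitMap h z :=
    h_lim (fun n => c (φ (ψ n))) (fun n => u (φ (ψ n))) (fun n => v (φ (ψ n))) z q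
      (fun n => hc1 _) (hcφ.comp hψ) (hctop.comp hmono.tendsto_atTop)
      (hulim.comp hmono.tendsto_atTop) hq fun n => hv _
  have hev : ∀ᶠ n in atTop, v (φ (ψ n)) ∈ Metric.ball q η := hq (Metric.ball_mem_nhds q hη)
  obtain ⟨n, hn⟩ := hev.exists
  exact hvη _ (Metric.mem_cthickening_of_dist_le _ q η _ hqmem (le_of_lt hn))

/-! ### Discrete inequalities -/

/-- Abel summation against a monotone weight. -/
theorem norm_sum_smul_sub_le {E : Type*} [NormedAddCommGroup E] [NormedSpace ℝ E] {g : ℕ → ℝ}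
    (hg : Monotone g) (hg0 : ∀ n, 0 ≤ g n) {e : ℕ → E} {δ : ℝ} {n : ℕ}
    (he : ∀ j, n ≤ j → ‖e j‖ ≤ δ) {m : ℕ} (hnm : n ≤ m) :
    ‖∑ j ∈ Finset.Ico n m, g j • (e (j + 1) - e j)‖ ≤ 2 * δ * g m := by
  -- Without the boundary term, what remains is `-g n • e n` minus the terms `(g (j + 1) - g j) • e
  -- (j + 1)`; the norm bounds telescope to `δ * g m`.
  have key : ‖∑ j ∈ Finset.Ico n m, g j • (e (j + 1) - e j) - g m • e m‖ ≤ δ * g m := by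
    induction m, hnm using Nat.le_induction with
    | base =>
      simp only [Finset.Ico_self, Finset.sum_empty, zero_sub, norm_neg, norm_smul,
        Real.norm_of_nonneg (hg0 n)]
      nlinarith [he n le_rfl, hg0 n]
    | succ m hnm ih =>
      rw [Finset.sum_Ico_succ_top hnm]
      have h1 : ∑ j ∈ Finset.Ico n m, g j • (e (j + 1) - e j) + g m • (e (m + 1) - e m)
          - g (m + 1) • e (m + 1)
          = (∑ j ∈ Finset.Ico n m, g j • (e (j + 1) - e j) - g m • e m)
            - (g (m + 1) - g m) • e (m + 1) := by module
      have h2 : 0 ≤ g (m + 1) - g m := sub_nonneg.2 (hg m.le_succ)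
      rw [h1]
      refine (norm_sub_le _ _).trans ?_
      rw [norm_smul, Real.norm_of_nonneg h2]
      nlinarith [he (m + 1) (by omega)]
  have h3 : ‖g m • e m‖ ≤ δ * g m := by
    rw [norm_smul, Real.norm_of_nonneg (hg0 m)]
    nlinarith [he m hnm, hg0 m]
  calc _ = ‖(∑ j ∈ Finset.Ico n m, g j • (e (j + 1) - e j) - g m • e m) + g m • e m‖ := by simp
    _ ≤ _ := norm_add_le _ _
    _ ≤ 2 * δ * g m := by linarith

/-- Discrete Grönwall. The induction runs on the right-hand side of `hR`, which grows per step by a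
factor at most `1 + L * a m ≤ exp (L * a m)`. -/
theorem le_mul_exp_of_le_add_sum {a R : ℕ → ℝ} {A L : ℝ} (ha : ∀ n, 0 ≤ a n) (hA : 0 ≤ A)
    (hL : 0 ≤ L) {n : ℕ} (hR0 : ∀ j, 0 ≤ R j)
    (hR : ∀ m, n ≤ m → R m ≤ A + L * ∑ j ∈ Finset.Ico n m, a j * R j) {m : ℕ} (hnm : n ≤ m) :
    R m ≤ A * Real.exp (L * ∑ j ∈ Finset.Ico n m, a j) := by
  refine (hR m hnm).trans ?_
  induction m, hnm using Nat.le_induction with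
  | base => simp
  | succ m hnm ih =>
    rw [Finset.sum_Ico_succ_top hnm, Finset.sum_Ico_succ_top hnm, mul_add, mul_add, Real.exp_add]
    have h0 : 0 ≤ A + L * ∑ j ∈ Finset.Ico n m, a j * R j :=
      add_nonneg hA (mul_nonneg hL (Finset.sum_nonneg fun j _ => mul_nonneg (ha j) (hR0 j)))
    have h1 : L * (a m * R m) ≤ L * a m * (A + L * ∑ j ∈ Finset.Ico n m, a j * R j) := by
      rw [← mul_assoc]
      exact mul_le_mul_of_nonneg_left (hR m hnm) (mul_nonneg hL (ha m))
    have h2 := Real.add_one_le_exp (L * a m)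
    calc A + (L * ∑ j ∈ Finset.Ico n m, a j * R j + L * (a m * R m))
        ≤ (A + L * ∑ j ∈ Finset.Ico n m, a j * R j) * (L * a m + 1) := by linarith
      _ ≤ (A * Real.exp (L * ∑ j ∈ Finset.Ico n m, a j)) * Real.exp (L * a m) :=
          mul_le_mul ih h2 (add_nonneg (mul_nonneg hL (ha m)) zero_le_one) (h0.trans ih)
      _ = _ := by ring

/-! ### The time scale of the step sizes -/

/-- The time elapsed before step `n`. -/
def elapsed (a : ℕ → ℝ) (n : ℕ) : ℝ := ∑ j ∈ Finset.range n, a j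

/-- The step during which time `τ` falls. -/
noncomputable def stepAt (a : ℕ → ℝ) (τ : ℝ) : ℕ := sInf {n | τ < elapsed a (n + 1)}

theorem elapsed_succ (a : ℕ → ℝ) (n : ℕ) : elapsed a (n + 1) = elapsed a n + a n :=
  Finset.sum_range_succ _ _

theorem sum_Ico_eq_elapsed_sub (a : ℕ → ℝ) {m n : ℕ} (hmn : m ≤ n) :
    ∑ j ∈ Finset.Ico m n, a j = elapsed a n - elapsed a m :=
  Finset.sum_Ico_eq_sub _ hmn

section StepAt

variable {a : ℕ → ℝ}

theorem strictMono_elapsed (ha : ∀ n, 0 < a n) : StrictMono (elapsed a) :=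
  strictMono_nat_of_lt_succ fun n => by rw [elapsed_succ]; linarith [ha n]

theorem tendsto_elapsed (ha : ∀ n, 0 < a n) (hs : ¬ Summable a) :
    Tendsto (elapsed a) atTop atTop :=
  (not_summable_iff_tendsto_nat_atTop_of_nonneg fun n => (ha n).le).1 hs

theorem lt_elapsed_stepAt (ha : ∀ n, 0 < a n) (hs : ¬ Summable a) (τ : ℝ) :
    τ < elapsed a (stepAt a τ + 1) := by
  have hne : {n | τ < elapsed a (n + 1)}.Nonempty :=
    (((tendsto_add_atTop_iff_nat 1).2 (tendsto_elapsed ha hs)).eventually_gt_atTop τ).exists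
  exact Nat.sInf_mem hne

theorem elapsed_stepAt_le {τ : ℝ} (hτ : 0 ≤ τ) : elapsed a (stepAt a τ) ≤ τ := by
  rcases hk : stepAt a τ with _ | k
  · simpa [elapsed] using hτ
  · have hnot : k ∉ {n | τ < elapsed a (n + 1)} :=
      Nat.notMem_of_lt_sInf (show k < stepAt a τ by omega)
    exact not_lt.1 hnot

theorem stepAt_le_iff (ha : ∀ n, 0 < a n) (hs : ¬ Summable a) {τ : ℝ} {n : ℕ} :
    stepAt a τ ≤ n ↔ τ < elapsed a (n + 1) :=
  ⟨fun hle => (lt_elapsed_stepAt ha hs τ).trans_le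
    ((strictMono_elapsed ha).monotone (Nat.succ_le_succ hle)), fun hlt => Nat.sInf_le hlt⟩

theorem stepAt_mono (ha : ∀ n, 0 < a n) (hs : ¬ Summable a) : Monotone (stepAt a) :=
  fun _ τ' hle => (stepAt_le_iff ha hs).2 (hle.trans_lt (lt_elapsed_stepAt ha hs τ'))

theorem stepAt_elapsed (ha : ∀ n, 0 < a n) (hs : ¬ Summable a) (n : ℕ) :
    stepAt a (elapsed a n) = n := by
  refine le_antisymm ((stepAt_le_iff ha hs).2 (strictMono_elapsed ha n.lt_succ_self)) ?_
  by_contra! hlt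
  exact absurd ((stepAt_le_iff ha hs).1 (Nat.le_sub_one_of_lt hlt))
    (by rw [Nat.sub_add_cancel (by omega)]; exact lt_irrefl _)

theorem tendsto_stepAt (ha : ∀ n, 0 < a n) (hs : ¬ Summable a) :
    Tendsto (stepAt a) atTop atTop :=
  tendsto_atTop_atTop_of_monotone (stepAt_mono ha hs) fun n =>
    ⟨elapsed a n, (stepAt_elapsed ha hs n).ge⟩

end StepAt

/-! ### Deterministic runs and their blow-up limits -/

/-- The running maximum of `1 + ‖x j‖`. -/
noncomputable def runningNorm {E : Type*} [Norm E] (x : ℕ → E) : ℕ →o ℝ :=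
  partialSups fun j => 1 + ‖x j‖

theorem one_add_norm_le_runningNorm {E : Type*} [Norm E] (x : ℕ → E) {j m : ℕ} (hjm : j ≤ m) :
    1 + ‖x j‖ ≤ runningNorm x m :=
  le_partialSups_of_le (fun j => 1 + ‖x j‖) hjm

theorem runningNorm_pos {E : Type*} [SeminormedAddCommGroup E] (x : ℕ → E) (m : ℕ) :
    0 < runningNorm x m :=
  (add_pos_of_pos_of_nonneg one_pos (norm_nonneg (x m))).trans_le
    (one_add_norm_le_runningNorm x le_rfl)

/-- A run `x (n + 1) = x n + a n • (y n + z n)`, `y n ∈ h (x n)`, whose noise `z`, summed with the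
weights `a`, is asymptotically negligible compared with the running maximum of `x`. -/
structure IsPerturbedRun {d : ℕ} (h : EuclideanSpace ℝ (Fin d) → Set (EuclideanSpace ℝ (Fin d)))
    (K : ℝ) (a : ℕ → ℝ) (x y z : ℕ → EuclideanSpace ℝ (Fin d)) : Prop where
  K_pos : 0 < K
  bound : ∀ x, ∀ w ∈ h x, ‖w‖ < K * (1 + ‖x‖)
  step_pos : ∀ n, 0 < a n
  not_summable : ¬ Summable a
  step_tendsto : Tendsto a atTop (𝓝 0)
  mem : ∀ n, y n ∈ h (x n)
  succ : ∀ n, x (n + 1) = x n + a n • (y n + z n)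
  noise : ∀ ε : ℝ, 0 < ε → ∃ N, ∀ n, N ≤ n → ∀ m, n ≤ m →
    ‖∑ j ∈ Finset.Ico n m, a j • z j‖ ≤ ε * runningNorm x m

namespace IsPerturbedRun

variable {d : ℕ} {h : EuclideanSpace ℝ (Fin d) → Set (EuclideanSpace ℝ (Fin d))} {K : ℝ}
  {a : ℕ → ℝ} {x y z : ℕ → EuclideanSpace ℝ (Fin d)}

theorem eq_add_sum (H : IsPerturbedRun h K a x y z) {n m : ℕ} (hnm : n ≤ m) :
    x m = x n + ∑ j ∈ Finset.Ico n m, a j • y j + ∑ j ∈ Finset.Ico n m, a j • z j := by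
  induction m, hnm using Nat.le_induction with
  | base => simp
  | succ m hnm ih =>
    rw [Finset.sum_Ico_succ_top hnm, Finset.sum_Ico_succ_top hnm, H.succ m]
    nth_rewrite 1 [ih]
    module

theorem norm_drift_le (H : IsPerturbedRun h K a x y z) (j : ℕ) :
    ‖y j‖ ≤ K * runningNorm x j :=
  (H.bound _ _ (H.mem j)).le.trans
    (mul_le_mul_of_nonneg_left (one_add_norm_le_runningNorm x le_rfl) H.K_pos.le)

theorem norm_sum_drift_le (H : IsPerturbedRun h K a x y z) (n m : ℕ) :
    ‖∑ j ∈ Finset.Ico n m, a j • y j‖ ≤ K * ∑ j ∈ Finset.Ico n m, a j * runningNorm x j := by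
  rw [Finset.mul_sum]
  refine norm_sum_le_of_le _ fun j _ => ?_
  rw [norm_smul, Real.norm_of_nonneg (H.step_pos j).le]
  nlinarith [H.norm_drift_le j, H.step_pos j]

/-- Over a bounded time span the running maximum grows by at most a constant factor. -/
theorem eventually_runningNorm_le (H : IsPerturbedRun h K a x y z) :
    ∃ N, ∀ n, N ≤ n → ∀ m, n ≤ m → runningNorm x m ≤
      2 * runningNorm x n * Real.exp (2 * K * (elapsed a m - elapsed a n)) := by
  -- With `ε = 1 / 2` the noise costs half the running maximum, absorbed on the left; both factors 2
  -- in the bound come from this.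
  obtain ⟨N, hN⟩ := H.noise (1 / 2) (by norm_num)
  refine ⟨N, fun n hn m hnm => ?_⟩
  rw [← sum_Ico_eq_elapsed_sub a hnm]
  have hR0 : ∀ j, 0 ≤ runningNorm x j := fun j => (runningNorm_pos x j).le
  refine le_mul_exp_of_le_add_sum (fun j => (H.step_pos j).le)
    (mul_nonneg zero_le_two (hR0 n)) (mul_nonneg zero_le_two H.K_pos.le) hR0 ?_ hnm
  intro m hnm
  have hsum0 : ∀ i, 0 ≤ ∑ j ∈ Finset.Ico n i, a j * runningNorm x j := fun i =>
    Finset.sum_nonneg fun j _ => mul_nonneg (H.step_pos j).le (hR0 j)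
  have key : runningNorm x m ≤ runningNorm x n
      + K * ∑ j ∈ Finset.Ico n m, a j * runningNorm x j + 1 / 2 * runningNorm x m := by
    refine partialSups_le _ _ _ fun i hi => ?_
    rcases le_total i n with hin | hni
    · have h1 := one_add_norm_le_runningNorm x hin
      have h2 := mul_nonneg H.K_pos.le (hsum0 m)
      linarith [hR0 m]
    · have h1 : ‖x i‖ ≤ ‖x n‖ + ‖∑ j ∈ Finset.Ico n i, a j • y j‖
          + ‖∑ j ∈ Finset.Ico n i, a j • z j‖ := by
        rw [H.eq_add_sum hni]; exact norm_add₃_le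
      have h2 := H.norm_sum_drift_le n i
      have h3 := hN n hn i hni
      have h4 : runningNorm x i ≤ runningNorm x m := (runningNorm x).monotone hi
      have h5 : K * ∑ j ∈ Finset.Ico n i, a j * runningNorm x j
          ≤ K * ∑ j ∈ Finset.Ico n m, a j * runningNorm x j := by
        refine mul_le_mul_of_nonneg_left ?_ H.K_pos.le
        exact Finset.sum_le_sum_of_subset_of_nonneg (Finset.Ico_subset_Ico_right hi)
          fun j _ _ => mul_nonneg (H.step_pos j).le (hR0 j)
      have h6 := one_add_norm_le_runningNorm x (le_refl n)
      linarith
  linarith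

/-! ### Runs started at time `τ k`, rescaled by `c k`, and their limits -/

variable {τ : ℕ → ℝ} {c : ℕ → ℕ} {B S : ℝ}

theorem tendsto_stepAt_add (H : IsPerturbedRun h K a x y z) (hτ : Tendsto τ atTop atTop) (s : ℝ) :
    Tendsto (fun k => stepAt a (τ k + s)) atTop atTop :=
  (tendsto_stepAt H.step_pos H.not_summable).comp (tendsto_atTop_add_const_right _ _ hτ)

theorem eventually_noise_le (H : IsPerturbedRun h K a x y z) (hτ : Tendsto τ atTop atTop)
    (hc : Tendsto c atTop atTop) (hB0 : 0 ≤ B)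
    (hB : ∀ᶠ k in atTop, ∀ j, elapsed a j ≤ τ k + S → runningNorm x j ≤ B * c k)
    (s : ℝ) {s' : ℝ} (hs' : s' ≤ S) {ε : ℝ} (hε : 0 < ε) :
    ∀ᶠ k in atTop, ∀ j, stepAt a (τ k + s) ≤ j → j ≤ stepAt a (τ k + s') →
      ‖(c k : ℝ)⁻¹ • ∑ l ∈ Finset.Ico (stepAt a (τ k + s)) j, a l • z l‖ ≤ ε := by
  -- Division by `B + 1` instead of `B` allows `B = 0`.
  obtain ⟨N, hN⟩ := H.noise (ε / (B + 1)) (by positivity)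
  filter_upwards [hB, (H.tendsto_stepAt_add hτ s).eventually_ge_atTop N,
    hc.eventually_ge_atTop 1, hτ.eventually_ge_atTop (-s')] with k hk hkN hck hτk j hj hj'
  have hc0 : (0 : ℝ) < c k := by exact_mod_cast hck
  have h1 : elapsed a j ≤ τ k + S :=
    ((strictMono_elapsed H.step_pos).monotone hj').trans
      ((elapsed_stepAt_le (by linarith)).trans (by linarith))
  have h2 := hN _ hkN j hj
  rw [norm_smul, norm_inv, Real.norm_of_nonneg hc0.le, inv_mul_le_iff₀ hc0]
  refine h2.trans ?_
  rw [div_mul_eq_mul_div, div_le_iff₀ (by positivity)]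
  have h3 := hk j h1
  nlinarith [mul_le_mul_of_nonneg_left h3 hε.le, mul_pos hc0 hε]

/-- Rounding a time down to the start of its step loses at most one step size, which tends to 0. -/
theorem tendsto_elapsed_stepAt_sub (H : IsPerturbedRun h K a x y z) (hτ : Tendsto τ atTop atTop)
    (s : ℝ) : Tendsto (fun k => elapsed a (stepAt a (τ k + s)) - τ k) atTop (𝓝 s) := by
  have h1 : Tendsto (fun k => s - a (stepAt a (τ k + s))) atTop (𝓝 s) := by
    simpa using (H.step_tendsto.comp (H.tendsto_stepAt_add hτ s)).const_sub s
  refine tendsto_of_tendsto_of_tendsto_of_le_of_le' h1 tendsto_const_nhds ?_ ?_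
  · refine Eventually.of_forall fun k => ?_
    have := lt_elapsed_stepAt H.step_pos H.not_summable (τ k + s)
    rw [elapsed_succ] at this
    linarith
  · filter_upwards [hτ.eventually_ge_atTop (-s)] with k hk
    linarith [elapsed_stepAt_le (a := a) (τ := τ k + s) (by linarith)]

/-- The rescaled drift has norm at most `K * B`; half of `ε` pays for the noise and half for
rounding times to steps. -/
theorem eventually_dist_le (H : IsPerturbedRun h K a x y z) (hτ : Tendsto τ atTop atTop)
    (hc : Tendsto c atTop atTop) (hB0 : 0 ≤ B)
    (hB : ∀ᶠ k in atTop, ∀ j, elapsed a j ≤ τ k + S → runningNorm x j ≤ B * c k)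
    (s : ℝ) {s' : ℝ} (hs' : s' ≤ S) {ε : ℝ} (hε : 0 < ε) :
    ∀ᶠ k in atTop, ∀ j, stepAt a (τ k + s) ≤ j → j ≤ stepAt a (τ k + s') →
      dist ((c k : ℝ)⁻¹ • x j) ((c k : ℝ)⁻¹ • x (stepAt a (τ k + s)))
        ≤ K * B * (s' - s) + ε := by
  have hlen : Tendsto (fun k => K * B * (elapsed a (stepAt a (τ k + s'))
      - elapsed a (stepAt a (τ k + s)))) atTop (𝓝 (K * B * (s' - s))) := by
    have := ((H.tendsto_elapsed_stepAt_sub hτ s').sub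
      (H.tendsto_elapsed_stepAt_sub hτ s)).const_mul (K * B)
    refine this.congr fun k => ?_
    ring
  filter_upwards [hB, H.eventually_noise_le hτ hc hB0 hB s hs' (half_pos hε),
    hc.eventually_ge_atTop 1, hτ.eventually_ge_atTop (-s'),
    hlen.eventually (gt_mem_nhds (lt_add_of_pos_right _ (half_pos hε)))]
    with k hk hnoise hck hτk hlen j hj hj'
  have hc0 : (0 : ℝ) < c k := by exact_mod_cast hck
  have hmono := (strictMono_elapsed H.step_pos).monotone
  have h1 : ‖(c k : ℝ)⁻¹ • ∑ l ∈ Finset.Ico (stepAt a (τ k + s)) j, a l • y l‖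
      ≤ K * B * (elapsed a j - elapsed a (stepAt a (τ k + s))) := by
    rw [norm_smul, norm_inv, Real.norm_of_nonneg hc0.le, inv_mul_le_iff₀ hc0,
      ← sum_Ico_eq_elapsed_sub a hj]
    refine (H.norm_sum_drift_le _ _).trans ?_
    rw [Finset.mul_sum, Finset.mul_sum, Finset.mul_sum]
    refine Finset.sum_le_sum fun l hl => ?_
    have h2 : elapsed a l ≤ τ k + S :=
      (hmono ((Finset.mem_Ico.1 hl).2.le.trans hj')).trans
        ((elapsed_stepAt_le (by linarith)).trans (by linarith))
    calc K * (a l * runningNorm x l) ≤ K * (a l * (B * c k)) :=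
          mul_le_mul_of_nonneg_left (mul_le_mul_of_nonneg_left (hk l h2) (H.step_pos l).le)
            H.K_pos.le
      _ = c k * (K * B * a l) := by ring
  have h3 := hnoise j hj hj'
  have h4 : K * B * (elapsed a j - elapsed a (stepAt a (τ k + s))) ≤
      K * B * (elapsed a (stepAt a (τ k + s')) - elapsed a (stepAt a (τ k + s))) :=
    mul_le_mul_of_nonneg_left (sub_le_sub_right (hmono hj') _) (mul_nonneg H.K_pos.le hB0)
  rw [dist_eq_norm, ← smul_sub]
  nth_rewrite 1 [H.eq_add_sum hj]
  rw [add_assoc, add_sub_cancel_left, smul_add]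
  refine (norm_add_le _ _).trans ?_
  linarith

variable {𝒰 : Ultrafilter ℕ} {X : ℝ → EuclideanSpace ℝ (Fin d)}

/-- Pointwise limits of rescaled runs are Lipschitz on left half-lines. -/
theorem lipschitzOnWith_limit (H : IsPerturbedRun h K a x y z) (hτ : Tendsto τ atTop atTop)
    (hc : Tendsto c atTop atTop) (hB0 : 0 ≤ B)
    (hB : ∀ᶠ k in atTop, ∀ j, elapsed a j ≤ τ k + S → runningNorm x j ≤ B * c k)
    (h𝒰 : (𝒰 : Filter ℕ) ≤ atTop)
    (hX : ∀ s, Tendsto (fun k => (c k : ℝ)⁻¹ • x (stepAt a (τ k + s))) 𝒰 (𝓝 (X s))) :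
    LipschitzOnWith (K * B).toNNReal X (Set.Iic S) := by
  have key : ∀ s s', s ≤ s' → s' ≤ S → dist (X s') (X s) ≤ K * B * (s' - s) := by
    intro s s' hss hs'
    refine le_of_forall_pos_le_add fun ε hε => ?_
    refine le_of_tendsto ((hX s').dist (hX s)) ?_
    filter_upwards [h𝒰 (H.eventually_dist_le hτ hc hB0 hB s hs' hε)] with k hk
    exact hk _ (stepAt_mono H.step_pos H.not_summable (by linarith)) le_rfl
  refine LipschitzOnWith.of_dist_le_mul fun s hs s' hs' => ?_
  rw [Real.coe_toNNReal _ (mul_nonneg H.K_pos.le hB0)]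
  rcases le_total s s' with hle | hle
  · rw [dist_comm, dist_comm s s', Real.dist_eq, abs_of_nonneg (sub_nonneg.2 hle)]
    exact key s s' hle hs'
  · rw [Real.dist_eq, abs_of_nonneg (sub_nonneg.2 hle)]
    exact key s' s hle hs

/-- Difference quotients of a limit of rescaled runs lie in every convex closed set that contains
the rescaled drift. -/
theorem slope_mem_of_eventually (H : IsPerturbedRun h K a x y z) (hτ : Tendsto τ atTop atTop)
    (hc : Tendsto c atTop atTop) (hB0 : 0 ≤ B)
    (hB : ∀ᶠ k in atTop, ∀ j, elapsed a j ≤ τ k + S → runningNorm x j ≤ B * c k)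
    (h𝒰 : (𝒰 : Filter ℕ) ≤ atTop)
    (hX : ∀ s, Tendsto (fun k => (c k : ℝ)⁻¹ • x (stepAt a (τ k + s))) 𝒰 (𝓝 (X s)))
    {s s' : ℝ} (hss' : s < s') (hs' : s' ≤ S) {D : Set (EuclideanSpace ℝ (Fin d))}
    (hDc : Convex ℝ D) (hD : IsClosed D)
    (hy : ∀ᶠ k in (𝒰 : Filter ℕ), ∀ j, stepAt a (τ k + s) ≤ j → j < stepAt a (τ k + s') →
      (c k : ℝ)⁻¹ • y j ∈ D) :
    (s' - s)⁻¹ • (X s' - X s) ∈ D := by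
  have hlen : Tendsto (fun k => elapsed a (stepAt a (τ k + s'))
      - elapsed a (stepAt a (τ k + s))) atTop (𝓝 (s' - s)) := by
    refine ((H.tendsto_elapsed_stepAt_sub hτ s').sub
      (H.tendsto_elapsed_stepAt_sub hτ s)).congr fun k => ?_
    ring
  have hzero : Tendsto (fun k => (c k : ℝ)⁻¹ •
      ∑ l ∈ Finset.Ico (stepAt a (τ k + s)) (stepAt a (τ k + s')), a l • z l)
      atTop (𝓝 0) := by
    rw [Metric.tendsto_nhds]
    intro ε hε
    filter_upwards [H.eventually_noise_le hτ hc hB0 hB s hs' (half_pos hε)] with k hk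
    rw [dist_zero_right]
    exact (hk _ (stepAt_mono H.step_pos H.not_summable (by linarith)) le_rfl).trans_lt
      (half_lt_self hε)
  have hlim := ((hlen.mono_left h𝒰).inv₀ (sub_pos.2 hss').ne').smul
    (((hX s').sub (hX s)).sub (hzero.mono_left h𝒰))
  rw [sub_zero] at hlim
  refine hD.mem_of_tendsto hlim ?_
  filter_upwards [hy, h𝒰 (hlen.eventually (lt_mem_nhds (sub_pos.2 hss')))] with k hk hpos
  have hle : stepAt a (τ k + s) ≤ stepAt a (τ k + s') :=
    stepAt_mono H.step_pos H.not_summable (by linarith)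
  -- The increment without its noise, divided by the elapsed time, is the mean of the rescaled
  -- drifts with weights `a j`.
  have hmem := hDc.centerMass_mem (t := Finset.Ico (stepAt a (τ k + s)) (stepAt a (τ k + s')))
    (w := a) (z := fun j => (c k : ℝ)⁻¹ • y j) (fun j _ => (H.step_pos j).le)
    (by rwa [sum_Ico_eq_elapsed_sub a hle])
    (fun j hj => hk j (Finset.mem_Ico.1 hj).1 (Finset.mem_Ico.1 hj).2)
  rw [Finset.centerMass, sum_Ico_eq_elapsed_sub a hle] at hmem
  convert hmem using 2
  rw [← smul_sub, ← smul_sub, H.eq_add_sum hle, add_assoc, add_sub_cancel_left,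
    add_sub_cancel_right, Finset.smul_sum]
  exact Finset.sum_congr rfl fun j _ => smul_comm _ _ _

/-- Just after time `s` the rescaled run stays near `X s`, so its drift lies in a closed thickening
of `limitMap h (X s)`. That set is convex, so slopes of `X` lie in it; then `s'` decreases to `s`,
and `η` is arbitrary. -/
theorem deriv_limit_mem (H : IsPerturbedRun h K a x y z) (hconv : ∀ u, Convex ℝ (h u))
    (h_lim : ∀ (c : ℕ → ℕ) (u v : ℕ → EuclideanSpace ℝ (Fin d)) (p q : EuclideanSpace ℝ (Fin d)),
      (∀ n, 1 ≤ c n) → StrictMono c → Tendsto c atTop atTop →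
      Tendsto u atTop (𝓝 p) → Tendsto v atTop (𝓝 q) →
      (∀ n, v n ∈ scaledMap h (c n : ℝ) (u n)) → q ∈ limitMap h p)
    (hτ : Tendsto τ atTop atTop) (hc : Tendsto c atTop atTop) (hB0 : 0 ≤ B)
    (hB : ∀ᶠ k in atTop, ∀ j, elapsed a j ≤ τ k + S → runningNorm x j ≤ B * c k)
    (h𝒰 : (𝒰 : Filter ℕ) ≤ atTop)
    (hX : ∀ s, Tendsto (fun k => (c k : ℝ)⁻¹ • x (stepAt a (τ k + s))) 𝒰 (𝓝 (X s)))
    {s : ℝ} (hsS : s < S) (hdiff : DifferentiableAt ℝ X s) : deriv X s ∈ limitMap h (X s) := by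
  have hclosed : limitMap h (X s) = closure (limitMap h (X s)) := isClosed_closure.closure_eq.symm
  rw [hclosed, Metric.closure_eq_iInter_cthickening]
  refine Set.mem_iInter₂.2 fun η hη => ?_
  obtain ⟨ε, hε, N, hN⟩ :=
    exists_scaledMap_subset_cthickening H.K_pos H.bound h_lim (X s) hη
  have hslope : Tendsto (slope X s) (𝓝[>] s) (𝓝 (deriv X s)) :=
    (hasDerivAt_iff_tendsto_slope.1 hdiff.hasDerivAt).mono_left
      (nhdsWithin_mono _ fun _ h => ne_of_gt h)
  refine Metric.isClosed_cthickening.mem_of_tendsto hslope ?_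
  -- The radius `ε` splits in three: drift over `[s, s']`, the slack in `eventually_dist_le`, and
  -- convergence at `s`.
  have hsmall : ∀ᶠ s' in 𝓝[>] s, K * B * (s' - s) < ε / 3 := by
    refine nhdsWithin_le_nhds (ContinuousAt.eventually_lt (by fun_prop) (by fun_prop) ?_)
    simpa using by positivity
  filter_upwards [hsmall, self_mem_nhdsWithin,
    nhdsWithin_le_nhds (gt_mem_nhds hsS)] with s' hs' hss' hs'S
  refine H.slope_mem_of_eventually hτ hc hB0 hB h𝒰 hX hss' (le_of_lt hs'S)
    ((convex_limitMap hconv _).cthickening η) Metric.isClosed_cthickening ?_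
  filter_upwards [h𝒰 (H.eventually_dist_le hτ hc hB0 hB s (le_of_lt hs'S)
      (ε := ε / 3) (by positivity)), h𝒰 (hc.eventually_ge_atTop N), h𝒰 (hc.eventually_ge_atTop 1),
    hX s (Metric.ball_mem_nhds (X s) (ε := ε / 3) (by positivity))] with k hk hcN hc1 hXk j hj hj'
  have hc0 : (c k : ℝ) ≠ 0 := by positivity
  refine hN (c k) hcN ((c k : ℝ)⁻¹ • x j) ?_ ?_
  · have h1 := hk j hj hj'.le
    have h2 : dist ((c k : ℝ)⁻¹ • x (stepAt a (τ k + s))) (X s) < ε / 3 := hXk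
    linarith [dist_triangle ((c k : ℝ)⁻¹ • x j) ((c k : ℝ)⁻¹ • x (stepAt a (τ k + s))) (X s)]
  · change (c k : ℝ) • (c k : ℝ)⁻¹ • y j ∈ h ((c k : ℝ) • (c k : ℝ)⁻¹ • x j)
    rw [smul_inv_smul₀ hc0, smul_inv_smul₀ hc0]
    exact H.mem j

/-- Rescaled runs have pointwise limits along ultrafilters, and these solve the limiting
inclusion. -/
theorem exists_limit_solution (H : IsPerturbedRun h K a x y z) (hconv : ∀ u, Convex ℝ (h u))
    (h_lim : ∀ (c : ℕ → ℕ) (u v : ℕ → EuclideanSpace ℝ (Fin d)) (p q : EuclideanSpace ℝ (Fin d)),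
      (∀ n, 1 ≤ c n) → StrictMono c → Tendsto c atTop atTop →
      Tendsto u atTop (𝓝 p) → Tendsto v atTop (𝓝 q) →
      (∀ n, v n ∈ scaledMap h (c n : ℝ) (u n)) → q ∈ limitMap h p)
    (hτ : Tendsto τ atTop atTop) (hc : Tendsto c atTop atTop)
    (hB : ∀ S : ℝ, ∃ B : ℝ, 0 ≤ B ∧
      ∀ᶠ k in atTop, ∀ j, elapsed a j ≤ τ k + S → runningNorm x j ≤ B * c k)
    (h𝒰 : (𝒰 : Filter ℕ) ≤ atTop) :
    ∃ X, IsDISolution (limitMap h) X ∧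
      ∀ s, Tendsto (fun k => (c k : ℝ)⁻¹ • x (stepAt a (τ k + s))) 𝒰 (𝓝 (X s)) := by
  -- Bounded sequences converge along an ultrafilter, so one `𝒰` serves all real `s` without
  -- diagonal extraction.
  have hex : ∀ s, ∃ p, Tendsto (fun k => (c k : ℝ)⁻¹ • x (stepAt a (τ k + s))) 𝒰 (𝓝 p) := by
    intro s
    obtain ⟨B, -, hBk⟩ := hB s
    have hev : ∀ᶠ k in (𝒰 : Filter ℕ), (c k : ℝ)⁻¹ • x (stepAt a (τ k + s)) ∈
        Metric.closedBall (0 : EuclideanSpace ℝ (Fin d)) B := by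
      filter_upwards [h𝒰 hBk, h𝒰 (hc.eventually_ge_atTop 1),
        h𝒰 (hτ.eventually_ge_atTop (-s))] with k hk hck hτk
      have hc0 : (0 : ℝ) < c k := by exact_mod_cast hck
      rw [mem_closedBall_zero_iff, norm_smul, norm_inv, Real.norm_of_nonneg hc0.le,
        inv_mul_le_iff₀ hc0]
      have h1 := hk _ (elapsed_stepAt_le (a := a) (τ := τ k + s) (by linarith))
      have h2 := one_add_norm_le_runningNorm x (le_refl (stepAt a (τ k + s)))
      linarith
    obtain ⟨p, -, hp⟩ := (isCompact_closedBall (0 : EuclideanSpace ℝ (Fin d)) B).ultrafilter_le_nhds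
      (𝒰.map fun k => (c k : ℝ)⁻¹ • x (stepAt a (τ k + s))) (le_principal_iff.2 hev)
    exact ⟨p, hp⟩
  choose X hX using hex
  refine ⟨X, ⟨fun b hb => ?_, ?_⟩, hX⟩
  · obtain ⟨B, hB0, hBk⟩ := hB b
    refine ((H.lipschitzOnWith_limit hτ hc hB0 hBk h𝒰 hX).mono ?_).absolutelyContinuousOnInterval
    rw [Set.uIcc_of_le hb]
    exact Set.Icc_subset_Iic_self
  · refine ae_restrict_of_ae ?_
    -- The Lipschitz constant depends on the half-line; integer endpoints keep the exceptional null
    -- sets countable in number.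
    have hae : ∀ S : ℕ, ∀ᵐ t : ℝ, t ∈ Set.Iic (S : ℝ) →
        DifferentiableWithinAt ℝ X (Set.Iic (S : ℝ)) t := by
      intro S
      obtain ⟨B, hB0, hBk⟩ := hB S
      exact (H.lipschitzOnWith_limit hτ hc hB0 hBk h𝒰 hX).ae_differentiableWithinAt_of_mem
    filter_upwards [ae_all_iff.2 hae] with t ht
    obtain ⟨S, hS⟩ := exists_nat_gt t
    have hdiff : DifferentiableAt ℝ X t := (ht S hS.le).differentiableAt (Iic_mem_nhds hS)
    obtain ⟨B, hB0, hBk⟩ := hB S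
    exact ⟨hdiff, H.deriv_limit_mem hconv h_lim hτ hc hB0 hBk h𝒰 hX hS hdiff⟩

end IsPerturbedRun

/-! ### Records and the contradiction with attraction -/

/-- An unbounded sequence has arbitrarily late and arbitrarily large records. -/
theorem exists_record_of_not_bddAbove {u : ℕ → ℝ} (hu : ¬ BddAbove (Set.range u)) (k : ℕ) :
    ∃ n, k ≤ n ∧ (k : ℝ) < u n ∧ ∀ j, j ≤ n → u j ≤ u n := by
  -- The first index above this threshold lies beyond `k`, and all earlier values are at most the
  -- threshold, so it is a record.
  have hex : ∃ n, max (k : ℝ) (partialSups u k) < u n := by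
    by_contra! hcon
    exact hu ⟨_, Set.forall_mem_range.2 hcon⟩
  classical
  have hspec := Nat.find_spec hex
  refine ⟨Nat.find hex, ?_, (le_max_left _ _).trans_lt hspec, fun j hj => ?_⟩
  · by_contra! hlt
    exact absurd ((le_max_right _ _).trans_lt hspec) (not_lt.2 (le_partialSups_of_le u hlt.le))
  · rcases hj.lt_or_eq with hlt | rfl
    · exact (not_lt.1 (Nat.find_min hex hlt)).trans hspec.le
    · exact le_rfl

theorem IsPerturbedRun.bddAbove {d : ℕ}
    {h : EuclideanSpace ℝ (Fin d) → Set (EuclideanSpace ℝ (Fin d))} {K : ℝ}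
    {a : ℕ → ℝ} {x y z : ℕ → EuclideanSpace ℝ (Fin d)}
    (H : IsPerturbedRun h K a x y z) (hconv : ∀ u, Convex ℝ (h u))
    (h_lim : ∀ (c : ℕ → ℕ) (u v : ℕ → EuclideanSpace ℝ (Fin d)) (p q : EuclideanSpace ℝ (Fin d)),
      (∀ n, 1 ≤ c n) → StrictMono c → Tendsto c atTop atTop →
      Tendsto u atTop (𝓝 p) → Tendsto v atTop (𝓝 q) →
      (∀ n, v n ∈ scaledMap h (c n : ℝ) (u n)) → q ∈ limitMap h p)
    {A U : Set (EuclideanSpace ℝ (Fin d))} (hAU : IsAttractingSet (limitMap h) A U)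
    (hU : Metric.closedBall 0 1 ⊆ U) (hA : A ⊆ Metric.ball 0 1) :
    BddAbove (Set.range fun n => ‖x n‖) := by
  by_contra hunb
  obtain ⟨δ, hδ, hδA⟩ := hAU.isCompact.exists_thickening_subset_open Metric.isOpen_ball hA
  obtain ⟨T, hT, hTA⟩ := hAU.attracts δ hδ
  choose n hkn hn hrec using exists_record_of_not_bddAbove hunb
  have hntop : Tendsto n atTop atTop := tendsto_atTop_mono hkn tendsto_id
  -- The scale is rounded up to an integer because `h_lim` concerns integer scales only.
  set c : ℕ → ℕ := fun k => ⌈‖x (n k)‖⌉₊ with hc_def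
  have hle_c : ∀ k, ‖x (n k)‖ ≤ c k := fun k => Nat.le_ceil _
  have hc_lt : ∀ k, (c k : ℝ) < ‖x (n k)‖ + 1 := fun k => Nat.ceil_lt_add_one (norm_nonneg _)
  have hkc : ∀ k, k < c k := fun k => by exact_mod_cast (hn k).trans_le (hle_c k)
  have hc0 : ∀ k, (0 : ℝ) < c k := fun k => by exact_mod_cast (Nat.zero_le k).trans_lt (hkc k)
  have hctop : Tendsto c atTop atTop := tendsto_atTop_mono (fun k => (hkc k).le) tendsto_id
  have hτ : Tendsto (fun k => elapsed a (n k) - T) atTop atTop :=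
    tendsto_atTop_add_const_right _ (-T)
      ((tendsto_elapsed H.step_pos H.not_summable).comp hntop)
  have hB : ∀ S : ℝ, ∃ B : ℝ, 0 ≤ B ∧ ∀ᶠ k in atTop, ∀ j,
      elapsed a j ≤ elapsed a (n k) - T + S → runningNorm x j ≤ B * c k := by
    intro S
    obtain ⟨N, hN⟩ := H.eventually_runningNorm_le
    -- One factor 2 bounds the running maximum at the record by `2 * c k`; the other is the Grönwall
    -- factor.
    refine ⟨4 * Real.exp (2 * K * |S|), by positivity, ?_⟩
    filter_upwards [hntop.eventually_ge_atTop N] with k hk j hj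
    have h1 : runningNorm x (n k) ≤ 2 * c k := by
      refine partialSups_le _ _ _ fun i hi => ?_
      have h2 : (1 : ℝ) ≤ c k := by exact_mod_cast (Nat.zero_le k).trans_lt (hkc k)
      linarith [hrec k i hi, hle_c k]
    have hexp : (1 : ℝ) ≤ Real.exp (2 * K * |S|) :=
      Real.one_le_exp (mul_nonneg (mul_nonneg zero_le_two H.K_pos.le) (abs_nonneg S))
    rcases le_total j (n k) with hle | hle
    · have h3 := (runningNorm x).monotone hle
      nlinarith [hc0 k]
    · have h4 := hN (n k) hk j hle
      have h5 : Real.exp (2 * K * (elapsed a j - elapsed a (n k))) ≤ Real.exp (2 * K * |S|) := by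
        refine Real.exp_le_exp.2 (mul_le_mul_of_nonneg_left ?_ (by linarith [H.K_pos]))
        linarith [le_abs_self S]
      calc runningNorm x j ≤ _ := h4
        _ ≤ 2 * (2 * c k) * Real.exp (2 * K * |S|) := by gcongr
        _ = _ := by ring
  obtain ⟨X, hXsol, hX⟩ := H.exists_limit_solution (𝒰 := hyperfilter ℕ) hconv h_lim hτ hctop hB
    Nat.hyperfilter_le_atTop
  have h0 : ‖X 0‖ ≤ 1 := by
    refine le_of_tendsto (hX 0).norm (Eventually.of_forall fun k => ?_)
    rw [norm_smul, norm_inv, Real.norm_of_nonneg (hc0 k).le, inv_mul_le_iff₀ (hc0 k), mul_one]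
    refine (hrec k _ ?_).trans (hle_c k)
    rw [← stepAt_elapsed H.step_pos H.not_summable (n k)]
    exact stepAt_mono H.step_pos H.not_summable (by
      rw [stepAt_elapsed H.step_pos H.not_summable]; linarith)
  -- Rescaled time `T` is exactly the record, where rounding up costs at most `(c k)⁻¹`.
  have hTnorm : 1 ≤ ‖X T‖ := by
    have hlim : Tendsto (fun k => 1 - (c k : ℝ)⁻¹) (hyperfilter ℕ : Filter ℕ) (𝓝 1) := by
      have h1 : Tendsto (fun k => 1 - (c k : ℝ)⁻¹) atTop (𝓝 (1 - 0)) :=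
        (tendsto_inv_atTop_zero.comp (tendsto_natCast_atTop_atTop.comp hctop)).const_sub 1
      rw [sub_zero] at h1
      exact h1.mono_left Nat.hyperfilter_le_atTop
    refine le_of_tendsto_of_tendsto hlim (hX T).norm (Eventually.of_forall fun k => ?_)
    simp only [sub_add_cancel]
    rw [stepAt_elapsed H.step_pos H.not_summable, norm_smul, norm_inv,
      Real.norm_of_nonneg (hc0 k).le]
    have h2 := hc_lt k
    have h3 := inv_pos.2 (hc0 k)
    have h4 : (c k : ℝ)⁻¹ * c k = 1 := inv_mul_cancel₀ (hc0 k).ne'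
    nlinarith
  have hmem : X T ∈ Metric.ball (0 : EuclideanSpace ℝ (Fin d)) 1 := by
    refine hδA (hTA ?_)
    refine Set.mem_iUnion₂.2 ⟨T, Set.self_mem_Ici, Set.mem_iUnion₂.2
      ⟨X 0, hU (mem_closedBall_zero_iff.2 h0), X, hXsol, rfl, rfl⟩⟩
  exact absurd (mem_ball_zero_iff.1 hmem) (not_lt.2 hTnorm)

/-! ### The noise -/

section Noise

variable {Ω : Type*} {m0 : MeasurableSpace Ω} {μ : Measure Ω}

/-- Partial sums of square integrable martingale differences with summable variances converge. -/
theorem ae_exists_tendsto_sum_of_condExp_eq_zero [IsProbabilityMeasure μ] {ℱ : Filtration ℕ m0}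
    {ξ : ℕ → Ω → ℝ} (hmeas : ∀ n, StronglyMeasurable[ℱ (n + 1)] (ξ n))
    (hL2 : ∀ n, MemLp (ξ n) 2 μ) (hcond : ∀ n, μ[ξ n | ℱ n] =ᵐ[μ] 0) {b : ℕ → ℝ}
    (hb : ∀ n, ∫ ω, ξ n ω ^ 2 ∂μ ≤ b n) (hbs : Summable b) :
    ∀ᵐ ω ∂μ, ∃ l, Tendsto (fun n => ∑ j ∈ Finset.range n, ξ j ω) atTop (𝓝 l) := by
  have hb0 : ∀ n, 0 ≤ b n := fun n => (integral_nonneg fun ω => sq_nonneg _).trans (hb n)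
  set Z : ℕ → Ω → ℝ := fun n ω => ∑ j ∈ Finset.range n, ξ j ω with hZ
  have hZsucc : ∀ n, Z (n + 1) = Z n + ξ n := fun n => by
    funext ω; simp [hZ, Finset.sum_range_succ]
  have hZmeas : ∀ n, StronglyMeasurable[ℱ n] (Z n) := fun n =>
    Finset.stronglyMeasurable_fun_sum _ fun j hj =>
      (hmeas j).mono (ℱ.mono (Nat.succ_le_of_lt (Finset.mem_range.1 hj)))
  have hZL2 : ∀ n, MemLp (Z n) 2 μ := fun n => memLp_finsetSum _ fun j _ => hL2 j
  have hZint : ∀ n, Integrable (Z n) μ := fun n => (hZL2 n).integrable one_le_two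
  have hmart : Martingale Z ℱ μ := by
    refine martingale_of_condExp_sub_eq_zero_nat hZmeas hZint fun n => ?_
    rw [hZsucc, add_sub_cancel_left]
    exact hcond n
  -- Orthogonality of increments: variances add, so the second moments stay bounded.
  have hcross : ∀ n, ∫ ω, Z n ω * ξ n ω ∂μ = 0 := by
    intro n
    have h1 : μ[Z n * ξ n | ℱ n] =ᵐ[μ] Z n * μ[ξ n | ℱ n] :=
      condExp_mul_of_stronglyMeasurable_left (hZmeas n) ((hZL2 n).integrable_mul (hL2 n))
        ((hL2 n).integrable one_le_two)
    have h2 : μ[Z n * ξ n | ℱ n] =ᵐ[μ] 0 := by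
      filter_upwards [h1, hcond n] with ω hω hω'
      rw [hω, Pi.mul_apply, hω']; simp
    have h3 := integral_condExp (μ := μ) (f := Z n * ξ n) (ℱ.le n)
    rw [integral_congr_ae h2] at h3
    simpa using h3.symm
  have hvar : ∀ n, ∫ ω, Z n ω ^ 2 ∂μ ≤ ∑ j ∈ Finset.range n, b j := by
    intro n
    induction n with
    | zero => simp [hZ]
    | succ n ih =>
      have h1 : ∀ ω, Z (n + 1) ω ^ 2 = Z n ω ^ 2 + 2 * (Z n ω * ξ n ω) + ξ n ω ^ 2 := fun ω => by
        rw [hZsucc, Pi.add_apply]; ring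
      have hi : Integrable (fun ω => 2 * (Z n ω * ξ n ω)) μ :=
        ((hZL2 n).integrable_mul (hL2 n)).const_mul 2
      simp_rw [h1]
      have hi' : Integrable (fun ω => Z n ω ^ 2 + 2 * (Z n ω * ξ n ω)) μ :=
        (hZL2 n).integrable_sq.add hi
      rw [integral_add hi' (hL2 n).integrable_sq,
        integral_add (hZL2 n).integrable_sq hi, integral_const_mul, hcross,
        Finset.sum_range_succ]
      linarith [hb n]
  refine hmart.submartingale.exists_ae_tendsto_of_bdd (R := (1 + ∑' j, b j).toNNReal) fun n => ?_
  rw [eLpNorm_one_eq_lintegral_enorm, ← ofReal_integral_norm_eq_lintegral_enorm (hZint n)]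
  refine ENNReal.ofReal_le_ofReal ?_
  -- The second moment bound becomes the bound in mean needed for martingale convergence.
  calc ∫ ω, ‖Z n ω‖ ∂μ ≤ ∫ ω, (1 + Z n ω ^ 2) ∂μ := by
        refine integral_mono (hZint n).norm ((integrable_const 1).add (hZL2 n).integrable_sq) ?_
        intro ω
        change ‖Z n ω‖ ≤ 1 + Z n ω ^ 2
        rw [Real.norm_eq_abs, ← sq_abs]
        nlinarith [sq_nonneg (|Z n ω| - 1), abs_nonneg (Z n ω)]
    _ = 1 + ∫ ω, Z n ω ^ 2 ∂μ := by
        rw [integral_add (integrable_const 1) (hZL2 n).integrable_sq]; simp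
    _ ≤ 1 + ∑' j, b j := by
        linarith [hvar n, hbs.sum_le_tsum (Finset.range n) fun j _ => hb0 j]

/-- The filtration of `noiseSigma`. -/
def noiseFiltration {d : ℕ} {x₀ : Ω → EuclideanSpace ℝ (Fin d)}
    {M : ℕ → Ω → EuclideanSpace ℝ (Fin d)} (h0 : Measurable x₀)
    (hM : ∀ n, Measurable (M (n + 1))) : Filtration ℕ m0 where
  seq := noiseSigma x₀ M
  mono' := fun _ _ hij =>
    sup_le_sup_left (biSup_mono fun _ hk => ⟨hk.1, hk.2.trans hij⟩) _
  le' := fun n => sup_le h0.comap_le (iSup₂_le fun i hi => by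
    obtain ⟨k, rfl⟩ := Nat.exists_eq_add_of_le' hi.1
    exact (hM k).comap_le)

/-- The running maximum of `1 +` the conditional standard deviations. -/
noncomputable def runningDeviation {d : ℕ} (μ : Measure Ω) (ℱ : Filtration ℕ m0)
    (z : ℕ → Ω → EuclideanSpace ℝ (Fin d)) (n : ℕ) (ω : Ω) : ℝ :=
  partialSups (fun j => 1 + √((μ[fun ω => ‖z j ω‖ ^ 2 | ℱ j]) ω)) n

theorem one_le_runningDeviation {d : ℕ} (ℱ : Filtration ℕ m0)
    (z : ℕ → Ω → EuclideanSpace ℝ (Fin d)) (n : ℕ) (ω : Ω) :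
    1 ≤ runningDeviation μ ℱ z n ω :=
  (le_add_of_nonneg_right (Real.sqrt_nonneg _)).trans
    (le_partialSups (fun j => 1 + √((μ[fun ω => ‖z j ω‖ ^ 2 | ℱ j]) ω)) n)

theorem monotone_runningDeviation {d : ℕ} (ℱ : Filtration ℕ m0)
    (z : ℕ → Ω → EuclideanSpace ℝ (Fin d)) (ω : Ω) :
    Monotone fun n => runningDeviation μ ℱ z n ω :=
  fun _ _ hij => (partialSups _).monotone hij

theorem condExp_le_runningDeviation_sq {d : ℕ} (ℱ : Filtration ℕ m0)
    (z : ℕ → Ω → EuclideanSpace ℝ (Fin d)) (n : ℕ) (ω : Ω) :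
    (μ[fun ω => ‖z n ω‖ ^ 2 | ℱ n]) ω ≤ runningDeviation μ ℱ z n ω ^ 2 := by
  have h1 : 1 + √((μ[fun ω => ‖z n ω‖ ^ 2 | ℱ n]) ω) ≤ runningDeviation μ ℱ z n ω :=
    le_partialSups (fun j => 1 + √((μ[fun ω => ‖z j ω‖ ^ 2 | ℱ j]) ω)) n
  refine Real.sqrt_le_left (by linarith [one_le_runningDeviation (μ := μ) ℱ z n ω]) |>.1 ?_
  linarith

theorem stronglyMeasurable_runningDeviation {d : ℕ} (ℱ : Filtration ℕ m0)
    (z : ℕ → Ω → EuclideanSpace ℝ (Fin d)) (n : ℕ) :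
    StronglyMeasurable[ℱ n] (runningDeviation μ ℱ z n) := by
  have hV : ∀ j, Measurable[ℱ j] fun ω => 1 + √((μ[fun ω => ‖z j ω‖ ^ 2 | ℱ j]) ω) :=
    fun j => (stronglyMeasurable_condExp.measurable.sqrt).const_add 1
  refine Measurable.stronglyMeasurable ?_
  induction n with
  | zero =>
    convert hV 0 using 1
    funext ω
    simp [runningDeviation]
  | succ n ih =>
    have hsucc : runningDeviation μ ℱ z (n + 1) = fun ω => runningDeviation μ ℱ z n ω ⊔
        (1 + √((μ[fun ω => ‖z (n + 1) ω‖ ^ 2 | ℱ (n + 1)]) ω)) :=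
      funext fun ω => partialSups_add_one _ n
    rw [hsucc]
    exact (ih.mono (ℱ.mono n.le_succ) le_rfl).sup (hV (n + 1))

/-- The weighted noise, normalized by the running maximum of its conditional deviations, is
almost surely summable. -/
theorem ae_exists_tendsto_normalized_noise [IsProbabilityMeasure μ] {d : ℕ} {ℱ : Filtration ℕ m0}
    {z : ℕ → Ω → EuclideanSpace ℝ (Fin d)} (hmeas : ∀ n, Measurable[ℱ (n + 1)] (z n))
    (hL2 : ∀ n, MemLp (z n) 2 μ) (hcond : ∀ n, μ[z n | ℱ n] =ᵐ[μ] 0) {a : ℕ → ℝ}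
    (ha : Summable fun n => a n ^ 2) :
    ∀ᵐ ω ∂μ, ∃ l, Tendsto (fun n => ∑ j ∈ Finset.range n,
      (a j / runningDeviation μ ℱ z j ω) • z j ω) atTop (𝓝 l) := by
  set g := runningDeviation μ ℱ z with hg
  have hg1 : ∀ n ω, 1 ≤ g n ω := fun n ω => one_le_runningDeviation ℱ z n ω
  have hw : ∀ n, StronglyMeasurable[ℱ n] fun ω => a n / g n ω := fun n =>
    (measurable_const.div (stronglyMeasurable_runningDeviation ℱ z n).measurable).stronglyMeasurable
  have hw_le : ∀ n ω, ‖a n / g n ω‖ ≤ |a n| := fun n ω => by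
    rw [norm_div, Real.norm_of_nonneg (zero_le_one.trans (hg1 n ω)), Real.norm_eq_abs]
    exact div_le_self (abs_nonneg _) (hg1 n ω)
  have hnormsq : ∀ n, Integrable (fun ω => ‖z n ω‖ ^ 2) μ := fun n =>
    (hL2 n).integrable_norm_pow two_ne_zero
  have hw2 : ∀ n, StronglyMeasurable[ℱ n] fun ω => (a n / g n ω) ^ 2 := fun n => (hw n).pow 2
  have hw2_le : ∀ n ω, ‖(a n / g n ω) ^ 2‖ ≤ |a n| ^ 2 := fun n ω => by
    rw [norm_pow]; exact pow_le_pow_left₀ (norm_nonneg _) (hw_le n ω) 2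
  have hw2int : ∀ n, Integrable ((fun ω => (a n / g n ω) ^ 2) * fun ω => ‖z n ω‖ ^ 2) μ :=
    fun n => (hnormsq n).bdd_mul ((hw2 n).mono (ℱ.le n)).aestronglyMeasurable
      (Eventually.of_forall (hw2_le n))
  -- The squared weight is `ℱ n`-measurable and leaves the conditional expectation, where it cancels
  -- the conditional variance.
  have hvar : ∀ n, ∫ ω, (a n / g n ω) ^ 2 * ‖z n ω‖ ^ 2 ∂μ ≤ a n ^ 2 := by
    intro n
    have h1 := condExp_mul_of_stronglyMeasurable_left (hw2 n) (hw2int n) (hnormsq n)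
    have h2 := integral_condExp (μ := μ) (f := (fun ω => (a n / g n ω) ^ 2) * fun ω => ‖z n ω‖ ^ 2)
      (ℱ.le n)
    rw [integral_congr_ae h1] at h2
    change _ = ∫ ω, (a n / g n ω) ^ 2 * ‖z n ω‖ ^ 2 ∂μ at h2
    rw [← h2]
    have h3 : ∫ _ : Ω, a n ^ 2 ∂μ = a n ^ 2 := by simp
    rw [← h3]
    refine integral_mono_ae (integrable_condExp.congr h1) (integrable_const _)
      (Eventually.of_forall fun ω => ?_)
    change (a n / g n ω) ^ 2 * (μ[fun ω => ‖z n ω‖ ^ 2 | ℱ n]) ω ≤ a n ^ 2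
    have h4 : (μ[fun ω => ‖z n ω‖ ^ 2 | ℱ n]) ω ≤ g n ω ^ 2 :=
      condExp_le_runningDeviation_sq ℱ z n ω
    have h5 : g n ω ≠ 0 := (zero_lt_one.trans_le (hg1 n ω)).ne'
    calc _ ≤ (a n / g n ω) ^ 2 * g n ω ^ 2 := mul_le_mul_of_nonneg_left h4 (sq_nonneg _)
      _ = a n ^ 2 := by field_simp
  have hcoord : ∀ i : Fin d, ∀ᵐ ω ∂μ, ∃ l, Tendsto (fun n => ∑ j ∈ Finset.range n,
      (a j / g j ω) * z j ω i) atTop (𝓝 l) := by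
    intro i
    have hzi : ∀ n, MemLp (fun ω => z n ω i) 2 μ := fun n =>
      (EuclideanSpace.proj (𝕜 := ℝ) i).comp_memLp' (hL2 n)
    have hL2i : ∀ n, MemLp (fun ω => (a n / g n ω) * z n ω i) 2 μ := fun n =>
      (hzi n).of_le_mul (c := |a n|)
        ((((hw n).mono (ℱ.le n)).aestronglyMeasurable).mul (hzi n).1)
        (Eventually.of_forall fun ω => by
          rw [norm_mul]; exact mul_le_mul_of_nonneg_right (hw_le n ω) (norm_nonneg _))
    refine ae_exists_tendsto_sum_of_condExp_eq_zero (ℱ := ℱ) ?_ hL2i ?_ ?_ ha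
    · intro n
      refine ((hw n).mono (ℱ.mono n.le_succ)).mul (Measurable.stronglyMeasurable ?_)
      exact (EuclideanSpace.proj (𝕜 := ℝ) i).continuous.measurable.comp (hmeas n)
    · intro n
      have h1 := condExp_mul_of_stronglyMeasurable_left (hw n)
        ((hL2i n).integrable one_le_two) ((hzi n).integrable one_le_two)
      have h2 := (EuclideanSpace.proj (𝕜 := ℝ) i).comp_condExp_comm (m := ℱ n)
        ((hL2 n).integrable one_le_two)
      refine h1.trans ?_
      filter_upwards [h2, hcond n] with ω hω hω'
      have h3 : (μ[fun ω => z n ω i | ℱ n]) ω = 0 := by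
        refine Eq.trans hω.symm ?_
        rw [Function.comp_apply, hω']
        simp
      rw [Pi.mul_apply, h3, mul_zero]; rfl
    · intro n
      refine le_trans (integral_mono (hL2i n).integrable_sq (hw2int n) fun ω => ?_) (hvar n)
      change ((a n / g n ω) * z n ω i) ^ 2 ≤ (a n / g n ω) ^ 2 * ‖z n ω‖ ^ 2
      rw [mul_pow]
      refine mul_le_mul_of_nonneg_left ?_ (sq_nonneg _)
      rw [← sq_abs, ← Real.norm_eq_abs]
      exact pow_le_pow_left₀ (norm_nonneg _) (PiLp.norm_apply_le _ i) 2
  filter_upwards [ae_all_iff.2 hcoord] with ω hω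
  choose l hl using hω
  refine ⟨WithLp.toLp 2 l, ?_⟩
  have h1 : Tendsto (fun n => fun i => ∑ j ∈ Finset.range n, (a j / g j ω) * z j ω i) atTop
      (𝓝 l) := tendsto_pi_nhds.2 hl
  refine (((PiLp.continuous_toLp 2 fun _ : Fin d => ℝ).tendsto l).comp h1).congr fun n => ?_
  ext i
  simp

end Noise

/-- Almost surely, the weighted noise is negligible compared with the running maximum of `x`.
No measurability of `x` is needed. -/
theorem ae_noise_le {d : ℕ} {Ω : Type*} [MeasurableSpace Ω] {μ : Measure Ω}
    [IsProbabilityMeasure μ] {a : ℕ → ℝ} {x M : ℕ → Ω → EuclideanSpace ℝ (Fin d)}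
    (ha_sq : Summable fun n => a n ^ 2) (hM : IsMartingaleDifference μ (x 0) M)
    (hM_sq : ∃ K : ℝ, 0 < K ∧ ∀ n,
      μ[fun ω => ‖M (n + 1) ω‖ ^ 2 | noiseSigma (x 0) M n]
        ≤ᵐ[μ] fun ω => K * (1 + ‖x n ω‖ ^ 2)) :
    ∀ᵐ ω ∂μ, ∀ ε : ℝ, 0 < ε → ∃ N, ∀ n, N ≤ n → ∀ m, n ≤ m →
      ‖∑ j ∈ Finset.Ico n m, a j • M (j + 1) ω‖ ≤ ε * runningNorm (fun k => x k ω) m := by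
  obtain ⟨K, hK, hKM⟩ := hM_sq
  set ℱ := noiseFiltration hM.measurable_init hM.measurable with hℱ
  have hmeas : ∀ n, Measurable[ℱ (n + 1)] (M (n + 1)) := fun n =>
    Measurable.of_comap_le (le_sup_of_le_right
      (le_iSup₂_of_le (n + 1) ⟨Nat.le_add_left 1 n, le_rfl⟩ le_rfl))
  have hconv := ae_exists_tendsto_normalized_noise (ℱ := ℱ) (z := fun n => M (n + 1)) hmeas
    hM.memLp hM.condExp_eq_zero ha_sq
  filter_upwards [hconv, ae_all_iff.2 hKM] with ω ⟨l, hl⟩ hω ε hε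
  set g : ℕ → ℝ := fun n => runningDeviation μ ℱ (fun n => M (n + 1)) n ω with hg
  have hg1 : ∀ n, 1 ≤ g n := fun n => one_le_runningDeviation ℱ _ n ω
  have hgmono : Monotone g := monotone_runningDeviation ℱ _ ω
  have hC : 0 < 1 + √K := by positivity
  have hgR : ∀ m, g m ≤ (1 + √K) * runningNorm (fun k => x k ω) m := by
    intro m
    refine partialSups_le _ _ _ fun j hj => ?_
    have h1 : √((μ[fun ω => ‖M (j + 1) ω‖ ^ 2 | ℱ j]) ω) ≤ √K * (1 + ‖x j ω‖) := by
      have h2 : (μ[fun ω => ‖M (j + 1) ω‖ ^ 2 | ℱ j]) ω ≤ K * (1 + ‖x j ω‖) ^ 2 :=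
        (hω j).trans (mul_le_mul_of_nonneg_left (by nlinarith [norm_nonneg (x j ω)]) hK.le)
      refine (Real.sqrt_le_sqrt h2).trans_eq ?_
      rw [Real.sqrt_mul hK.le, Real.sqrt_sq (by positivity)]
    have h3 := one_add_norm_le_runningNorm (fun k => x k ω) hj
    have h4 := mul_le_mul_of_nonneg_left h3 hC.le
    nlinarith [norm_nonneg (x j ω)]
  -- `e` is minus the tail of the normalized series; its increments times `g` recover the original
  -- noise.
  set e : ℕ → EuclideanSpace ℝ (Fin d) := fun n =>
    (∑ j ∈ Finset.range n, (a j / g j) • M (j + 1) ω) - l with he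
  have he0 : Tendsto (fun n => ‖e n‖) atTop (𝓝 0) := by
    have h1 : Tendsto e atTop (𝓝 (l - l)) := hl.sub_const l
    rw [sub_self] at h1
    simpa using h1.norm
  -- The 2 is the constant of Abel summation, and `1 + √K` compares `g` with the running maximum of
  -- the path.
  have hδ : 0 < ε / (2 * (1 + √K)) := by positivity
  obtain ⟨N, hN⟩ := eventually_atTop.1 (he0.eventually (gt_mem_nhds hδ))
  refine ⟨N, fun n hn m hnm => ?_⟩
  have h1 := norm_sum_smul_sub_le hgmono (fun n => zero_le_one.trans (hg1 n))
    (fun j hj => (hN j (hn.trans hj)).le) hnm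
  have h2 : ∀ j, g j • (e (j + 1) - e j) = a j • M (j + 1) ω := by
    intro j
    have hgj : g j ≠ 0 := (zero_lt_one.trans_le (hg1 j)).ne'
    simp only [he, Finset.sum_range_succ]
    rw [sub_sub_sub_cancel_right, add_sub_cancel_left, smul_smul, mul_div_cancel₀ _ hgj]
  simp_rw [h2] at h1
  refine h1.trans ((mul_le_mul_of_nonneg_left (hgR m) (by positivity)).trans_eq ?_)
  field_simp

/-! ### Almost sure boundedness -/

theorem theorem1 {d : ℕ} {Ω : Type*} [MeasurableSpace Ω] (μ : Measure Ω) [IsProbabilityMeasure μ]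
    (h : EuclideanSpace ℝ (Fin d) → Set (EuclideanSpace ℝ (Fin d)))
    (a : ℕ → ℝ) (x y M : ℕ → Ω → EuclideanSpace ℝ (Fin d))
    -- the stochastic recursive inclusion
    (hrec : ∀ᵐ ω ∂μ, ∀ n,
      y n ω ∈ h (x n ω) ∧ x (n + 1) ω = x n ω + a n • (y n ω + M (n + 1) ω))
    -- the drift
    (hh : IsMarchaud h)
    -- the step sizes
    (ha_pos : ∀ n, 0 < a n) (ha_sum : ¬ Summable a) (ha_sq : Summable fun n => a n ^ 2)
    -- the noise
    (hM : IsMartingaleDifference μ (x 0) M)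
    (hM_sq : ∃ K : ℝ, 0 < K ∧ ∀ n,
      μ[fun ω => ‖M (n + 1) ω‖ ^ 2 | noiseSigma (x 0) M n]
        ≤ᵐ[μ] fun ω => K * (1 + ‖x n ω‖ ^ 2))
    -- the limiting inclusion and its attracting set
    (h_nonempty : ∀ z, (limitMap h z).Nonempty)
    (h_attr : ∃ A U : Set (EuclideanSpace ℝ (Fin d)), IsAttractingSet (limitMap h) A U ∧
      Metric.closedBall 0 1 ⊆ U ∧ A ⊆ Metric.ball 0 1)
    -- limits of rescaled selections
    (h_lim : ∀ (c : ℕ → ℕ) (u v : ℕ → EuclideanSpace ℝ (Fin d)) (p q : EuclideanSpace ℝ (Fin d)),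
      (∀ n, 1 ≤ c n) → StrictMono c → Tendsto c atTop atTop →
      Tendsto u atTop (𝓝 p) → Tendsto v atTop (𝓝 q) →
      (∀ n, v n ∈ scaledMap h (c n : ℝ) (u n)) → q ∈ limitMap h p) :
    ∀ᵐ ω ∂μ, BddAbove (Set.range fun n => ‖x n ω‖) := by
  obtain ⟨K, hK, hbound⟩ := hh.bounded
  obtain ⟨A, U, hAU, hU, hA⟩ := h_attr
  have ha0 : Tendsto a atTop (𝓝 0) := by
    have h1 := ha_sq.tendsto_atTop_zero.sqrt
    simp only [Real.sqrt_zero] at h1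
    exact h1.congr fun n => Real.sqrt_sq (ha_pos n).le
  filter_upwards [hrec, ae_noise_le ha_sq hM hM_sq] with ω hω hnoise
  have H : IsPerturbedRun h K a (fun n => x n ω) (fun n => y n ω) (fun n => M (n + 1) ω) :=
    { K_pos := hK
      bound := hbound
      step_pos := ha_pos
      not_summable := ha_sum
      step_tendsto := ha0
      mem := fun n => (hω n).1
      succ := fun n => (hω n).2
      noise := hnoise }
  exact H.bddAbove hh.convex h_lim hAU hU hA
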